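/- Consider the simply typed $\lambda$-calculus over one base type $o$, with a constant $\bot:o$ and countably many variables of each type, terms being taken up to renaming of bound variables. Let $\mathit{NF}_\sigma$ be the set of (possibly open) $\beta\eta$-normal forms of type $\sigma$, written in $\eta$-long form: they are the terms $\lambda x_1\ldots x_m.\bot$ and $\lambda x_1\ldots x_m.\,x\,t_1\ldots t_k$ of type $\sigma$, where the body has type $o$, $x$ is a bound or free variable, and the $t_l$ are again such normal forms. Every term $t$ is $\beta\eta$-convertible to exactly one normal form, denoted $[t]_{\beta\eta}$. For $t\in \mathit{NF}_{\sigma\to\tau}$ and $s\in \mathit{NF}_\sigma$ put $t\cdot s=[ts]_{\beta\eta}$ (also written $ts$ below). The $n$-th approximant $t_n$ of a normal form $t$ is given by $(\lambda\vec x.\bot)_n=\lambda\vec x.\bot$, $(\lambda\vec x.\,x\,t_1\ldots t_k)_0=\lambda\vec x.\bot$ and $(\lambda\vec x.\,x\,t_1\ldots t_k)_{n+1}=\lambda\vec x.\,x\,(t_1)_n\ldots(t_k)_n$. Define $d^{\mathit{NF}}_\sigma:\mathit{NF}_\sigma\times \mathit{NF}_\sigma\to\mathbb R_{\ge 0}$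 by induction on $\sigma$: $d^{\mathit{NF}}_o(t,s)$ is $0$ if $t=s$ and $1$ otherwise; $d^{\mathit{NF}}_{\sigma\to\tau}(t,t')=2^{-m}$, where $m$ is the largest $n\in\mathbb N$ such that (1) $t_n=t'_n$, and (2) for all $s,s'\in \mathit{NF}_\sigma$, $d^{\mathit{NF}}_\sigma(s,s')\le 2^{-n}$ implies $d^{\mathit{NF}}_\tau(ts,t's')\le 2^{-n}$, and $d^{\mathit{NF}}_{\sigma\to\tau}(t,t')=0$ if there is no largest such $n$. A *partial ultrametric* on $X$ is a function $d:X\times X\to[0,\infty]$ that is symmetric and satisfies $d(x,y)\le\max\{d(x,z),d(z,y)\}$, $d(x,x)\le d(x,y)$ and $d(y,y)\le d(x,y)$. *Non-expansive* means that distances do not increase, products carrying the maximum distance ($0$ on the empty product). Let $\mathcal A$ consist of sets $A_i$ with distances $d_i$ ($i$ a simple type), application maps $A_{i\to j}\times A_i\to A_j$, an element $\bot\in A_o$, and maps $\Lambda_{w,j}$ ($w=i_1\ldots i_k$ a word of types, $j$ a type) from the closed $\lambda$-terms of type $w\to j=i_1\to\cdots\to i_k\to j$ with elements of $A$ as extra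 constants to $A_{w\to j}$. Put $A_w=A_{i_1}\times\cdots\times A_{i_k}$, and let $\mathrm{Met}^{\mathcal A}(A_w;A_j)$ be the set of non-expansive $f:A_w\to A_j$ represented by some closed term $t$, that is, $f(\vec a)=\Lambda_{w,j}(t)\cdot a_1\cdots a_k$ for all $\vec a$; give it the distance $\Xi(f,g)=\inf\{\delta\mid\forall \vec a,\vec b\;\; d_j(f(\vec a),g(\vec b))\le\max\{\delta,d_w(\vec a,\vec b)\}\}$. Then $\mathcal A$ is a *partial quantitative extensional $\lambda$-algebra* if (i) every $d_i$ is a partial ultrametric, application is non-expansive, and $d_o(\bot,\bot)=0$; (ii) the sets $\mathrm{Met}^{\mathcal A}(A_w;A_j)$ contain the projections and are closed under composition; (iii) there are well-defined maps $\boldsymbol\Lambda:\mathrm{Met}^{\mathcal A}(A_{w*i};A_j)\to \mathrm{Met}^{\mathcal A}(A_w;A_{i\to j})$, with $\boldsymbol\Lambda(h)(\vec a)=\Lambda_{w*i,j}(t)\cdot\vec a$ for every closed term $t$ representing $h$, and $\mathbf{Ev}:\mathrm{Met}^{\mathcal A}(A_w;A_{i\to j})\to \mathrm{Met}^{\mathcal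 A}(A_{w*i};A_j)$, with $\mathbf{Ev}(f)(\vec z,x)=f(\vec z)\cdot x$; they are mutually inverse, natural in $w$, and non-expansive with respect to $\Xi$. **Statement.** For all $\sigma,\tau$, $(\mathit{NF}_\sigma,d^{\mathit{NF}}_\sigma)$ is a partial ultrametric space and application is non-expansive: $d^{\mathit{NF}}_\tau(ts,t's')\le\max\{d^{\mathit{NF}}_{\sigma\to\tau}(t,t'),d^{\mathit{NF}}_\sigma(s,s')\}$. With this application, this distance, the constant $\bot$, and $\Lambda_{w,j}(t)=[t]_{\beta\eta}$, the sets $\mathit{NF}_\sigma$ form a partial quantitative extensional $\lambda$-algebra. -/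

import Mathlib

open scoped NNReal ENNReal

noncomputable section

namespace STLC

/-! ### Simple types, contexts, terms -/

/-- Simple types over one base type `o`. -/
inductive Ty : Type
  | o : Ty
  | arr : Ty → Ty → Ty

/-- `Idx w i`: an occurrence of the sort `i` in the word `w` (a typed de Bruijn index).
Words of sorts are written with their last letter first, so `i :: w` is the word `w * i`. -/
inductive Idx : List Ty → Ty → Type
  | zero {w : List Ty} {i : Ty} : Idx (i :: w) i
  | succ {w : List Ty} {i k : Ty} : Idx w i → Idx (k :: w) i

/-- The type `w → j`, that is `i₁ → (i₂ → ⋯ → (iₙ → j))` for `w = i₁ ⋯ iₙ`. -/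
def arrows : List Ty → Ty → Ty
  | [], j => j
  | i :: w, j => arrows w (Ty.arr i j)

/-- Typed lambda-terms (up to renaming of bound variables) over application, abstraction and the
constant `bot` of type `o`, with parameters in the sorted set `V`. `Γ` lists the types of the
indices that are not yet bound; elements of `Term V [] σ` have none.
* With `V = Var` (named variables), `Term Var [] σ` is the set of all terms of type `σ`,
  the parameters being the free variables.
* With `V = A` the carrier of an algebra, `Term A [] σ` is the set of closed terms of type `σ`
  with the elements of `A` as additional constants. -/
inductive Term (V : Ty → Type) : List Ty → Ty → Type
  | bot {Γ : List Ty} : Term V Γ Ty.o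
  | par {Γ : List Ty} {σ : Ty} : V σ → Term V Γ σ
  | bvar {Γ : List Ty} {σ : Ty} : Idx Γ σ → Term V Γ σ
  | app {Γ : List Ty} {σ τ : Ty} : Term V Γ (Ty.arr σ τ) → Term V Γ σ → Term V Γ τ
  | lam {Γ : List Ty} {σ τ : Ty} : Term V (σ :: Γ) τ → Term V Γ (Ty.arr σ τ)

namespace Term

/-- Extension of a renaming under a binder. -/
def liftRen {Γ Δ : List Ty} (r : ∀ σ, Idx Γ σ → Idx Δ σ) (κ : Ty) :
    ∀ σ, Idx (κ :: Γ) σ → Idx (κ :: Δ) σ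
  | _, Idx.zero => Idx.zero
  | _, Idx.succ k => Idx.succ (r _ k)

/-- Renaming of indices. -/
def rename {V : Ty → Type} : ∀ {Γ Δ : List Ty} {σ : Ty},
    (∀ σ, Idx Γ σ → Idx Δ σ) → Term V Γ σ → Term V Δ σ
  | _, _, _, _, bot => bot
  | _, _, _, _, par x => par x
  | _, _, _, r, bvar k => bvar (r _ k)
  | _, _, _, r, app t s => app (rename r t) (rename r s)
  | _, _, _, r, lam t => lam (rename (liftRen r _) t)

/-- Weakening by one index. -/
def weaken {V : Ty → Type} {Γ : List Ty} {σ : Ty} (κ : Ty) (t : Term V Γ σ) :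
    Term V (κ :: Γ) σ :=
  rename (fun _ k => Idx.succ k) t

/-- A term without unbound indices, seen in an arbitrary context. -/
def weakenAll {V : Ty → Type} {σ : Ty} (Γ : List Ty) (t : Term V [] σ) : Term V Γ σ :=
  rename (Γ := []) (fun _ k => nomatch k) t

/-- Extension of a substitution under a binder. -/
def liftSub {V : Ty → Type} {Γ Δ : List Ty} (f : ∀ σ, Idx Γ σ → Term V Δ σ) (κ : Ty) :
    ∀ σ, Idx (κ :: Γ) σ → Term V (κ :: Δ) σ
  | _, Idx.zero => bvar Idx.zero
  | _, Idx.succ k => weaken κ (f _ k)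

/-- Simultaneous (capture-avoiding) substitution for indices. -/
def subst {V : Ty → Type} : ∀ {Γ Δ : List Ty} {σ : Ty},
    (∀ σ, Idx Γ σ → Term V Δ σ) → Term V Γ σ → Term V Δ σ
  | _, _, _, _, bot => bot
  | _, _, _, _, par x => par x
  | _, _, _, f, bvar k => f _ k
  | _, _, _, f, app t s => app (subst f t) (subst f s)
  | _, _, _, f, lam t => lam (subst (liftSub f _) t)

/-- The substitution of `s` for the last index. -/
def single {V : Ty → Type} {Γ : List Ty} {κ : Ty} (s : Term V Γ κ) :
    ∀ σ, Idx (κ :: Γ) σ → Term V Γ σ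
  | _, Idx.zero => s
  | _, Idx.succ k => bvar k

/-- `t[s/x]`, where `x` is the last index of `t`. -/
def inst {V : Ty → Type} {Γ : List Ty} {κ σ : Ty} (t : Term V (κ :: Γ) σ) (s : Term V Γ κ) :
    Term V Γ σ :=
  subst (single s) t

/-- (Capture-avoiding) replacement of the parameters of a term by terms. -/
def substPar {V W : Ty → Type} (f : ∀ σ, V σ → Term W [] σ) :
    ∀ {Γ : List Ty} {σ : Ty}, Term V Γ σ → Term W Γ σ
  | _, _, bot => bot
  | _, _, par x => weakenAll _ (f _ x)
  | _, _, bvar k => bvar k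
  | _, _, app t s => app (substPar f t) (substPar f s)
  | _, _, lam t => lam (substPar f t)

end Term

/-- Beta-eta-conversion. -/
inductive BetaEta {V : Ty → Type} : ∀ {Γ : List Ty} {σ : Ty}, Term V Γ σ → Term V Γ σ → Prop
  | beta {Γ : List Ty} {σ τ : Ty} (t : Term V (σ :: Γ) τ) (s : Term V Γ σ) :
      BetaEta (Term.app (Term.lam t) s) (Term.inst t s)
  | eta {Γ : List Ty} {σ τ : Ty} (t : Term V Γ (Ty.arr σ τ)) :
      BetaEta (Term.lam (Term.app (Term.weaken σ t) (Term.bvar Idx.zero))) t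
  | app {Γ : List Ty} {σ τ : Ty} {t t' : Term V Γ (Ty.arr σ τ)} {s s' : Term V Γ σ} :
      BetaEta t t' → BetaEta s s' → BetaEta (Term.app t s) (Term.app t' s')
  | lam {Γ : List Ty} {σ τ : Ty} {t t' : Term V (σ :: Γ) τ} :
      BetaEta t t' → BetaEta (Term.lam t) (Term.lam t')
  | refl {Γ : List Ty} {σ : Ty} (t : Term V Γ σ) : BetaEta t t
  | symm {Γ : List Ty} {σ : Ty} {t t' : Term V Γ σ} : BetaEta t t' → BetaEta t' t
  | trans {Γ : List Ty} {σ : Ty} {t t' u : Term V Γ σ} :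
      BetaEta t t' → BetaEta t' u → BetaEta t u

/-! ### Normal forms -/

/-- Countably many named variables of each type. -/
def Var (_ : Ty) : Type := ℕ

mutual

/-- Beta-eta-normal forms in eta-long form: `λ x₁ … xₘ. ⊥` and `λ x₁ … xₘ. x t₁ … tₖ`
with the body `x t₁ … tₖ` of type `o`. -/
inductive Nf : List Ty → Ty → Type
  | lam {Γ : List Ty} {σ τ : Ty} : Nf (σ :: Γ) τ → Nf Γ (Ty.arr σ τ)
  | bot {Γ : List Ty} : Nf Γ Ty.o
  | ne {Γ : List Ty} : Ne Γ Ty.o → Nf Γ Ty.o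

/-- A variable (free or bound) applied to normal forms, `x t₁ … tₖ`. -/
inductive Ne : List Ty → Ty → Type
  | free {Γ : List Ty} {σ : Ty} : Var σ → Ne Γ σ
  | bvar {Γ : List Ty} {σ : Ty} : Idx Γ σ → Ne Γ σ
  | app {Γ : List Ty} {σ τ : Ty} : Ne Γ (Ty.arr σ τ) → Nf Γ σ → Ne Γ τ

end

mutual

/-- The underlying term of a normal form. -/
def Nf.toTerm : ∀ {Γ : List Ty} {σ : Ty}, Nf Γ σ → Term Var Γ σ
  | _, _, .lam t => Term.lam t.toTerm
  | _, _, .bot => Term.bot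
  | _, _, .ne u => u.toTerm

/-- The underlying term of `x t₁ … tₖ`. -/
def Ne.toTerm : ∀ {Γ : List Ty} {σ : Ty}, Ne Γ σ → Term Var Γ σ
  | _, _, .free x => Term.par x
  | _, _, .bvar k => Term.bvar k
  | _, _, .app u t => Term.app u.toTerm t.toTerm

end

mutual

/-- The `n`-th approximant: `(λ x⃗. x t₁ … tₖ)₀ = λ x⃗. ⊥`,
`(λ x⃗. x t₁ … tₖ)ₙ₊₁ = λ x⃗. x (t₁)ₙ … (tₖ)ₙ`, and `(λ x⃗. ⊥)ₙ = λ x⃗. ⊥`. -/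
def Nf.approx : ∀ {Γ : List Ty} {σ : Ty}, ℕ → Nf Γ σ → Nf Γ σ
  | _, _, n, .lam t => .lam (t.approx n)
  | _, _, _, .bot => .bot
  | _, _, 0, .ne _ => .bot
  | _, _, n + 1, .ne u => .ne (u.approxArgs n)

/-- `x t₁ … tₖ ↦ x (t₁)ₙ … (tₖ)ₙ`. -/
def Ne.approxArgs : ∀ {Γ : List Ty} {σ : Ty}, ℕ → Ne Γ σ → Ne Γ σ
  | _, _, _, .free x => .free x
  | _, _, _, .bvar k => .bvar k
  | _, _, n, .app u t => .app (u.approxArgs n) (t.approx n)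

end

/-- The set of normal forms of type `σ` (free variables of every type are allowed). -/
abbrev NF (σ : Ty) : Type := Nf [] σ

/-- The normal form `λ x₁ … xₘ. ⊥`. -/
def Nf.botAt : ∀ (Γ : List Ty) (σ : Ty), Nf Γ σ
  | _, .o => .bot
  | Γ, .arr σ τ => .lam (Nf.botAt (σ :: Γ) τ)

instance (Γ : List Ty) (σ : Ty) : Nonempty (Nf Γ σ) := ⟨Nf.botAt Γ σ⟩

/-- The normal form of a term: the normal form that it is convertible to. -/
def normalForm {σ : Ty} (t : Term Var [] σ) : NF σ :=
  Classical.epsilon fun u : NF σ => BetaEta t u.toTerm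

/-- Application of normal forms, `t · s = [t s]`. -/
def NF.app {σ τ : Ty} (t : NF (Ty.arr σ τ)) (s : NF σ) : NF τ :=
  normalForm (Term.app t.toTerm s.toTerm)

open Classical in
/-- The distance on normal forms. -/
def dNF : ∀ σ : Ty, NF σ → NF σ → ℝ≥0
  | .o, t, s => if t = s then 0 else 1
  | .arr σ τ, t, t' =>
      if h : ∃ m : ℕ, IsGreatest {n : ℕ | t.approx n = t'.approx n ∧
          ∀ s s' : NF σ, dNF σ s s' ≤ 1 / 2 ^ n → dNF τ (t.app s) (t'.app s') ≤ 1 / 2 ^ n} m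
      then 1 / 2 ^ h.choose
      else 0

/-! ### Partial ultrametric spaces and partial quantitative lambda-algebras -/

/-- Partial (pseudo-)ultrametrics: self-distances need not vanish. -/
structure IsPartialUltrametric {X : Type} (d : X → X → ℝ≥0∞) : Prop where
  symm : ∀ x y, d x y = d y x
  trans : ∀ x y z, d x y ≤ max (d x z) (d z y)
  refl_left : ∀ x y, d x x ≤ d x y
  refl_right : ∀ x y, d y y ≤ d x y

/-- `Ξ(f, g) = inf {δ | ∀ x y, dY (f x) (g y) ≤ max δ (dX x y)}`. -/
def xiDist {X Y : Type} (dX : X → X → ℝ≥0∞) (dY : Y → Y → ℝ≥0∞) (f g : X → Y) : ℝ≥0∞ :=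
  sInf {δ : ℝ≥0∞ | ∀ x y, dY (f x) (g y) ≤ max δ (dX x y)}

/-- The product `A_w` of the sorts of `w`. -/
abbrev Tuple (A : Ty → Type) (w : List Ty) : Type := ∀ i, Idx w i → A i

/-- The tuple `⟨a, b⟩` in `A_{w * i}`, for `a` in `A_w` and `b` in `A_i`. -/
def Tuple.snoc {A : Ty → Type} {w : List Ty} {i : Ty} (a : Tuple A w) (b : A i) :
    Tuple A (i :: w)
  | _, Idx.zero => b
  | _, Idx.succ k => a _ k

/-- The data of a quantitative applicative lambda-algebra over the signature consisting of the
application symbols and the constant `⊥` of sort `o`: carriers, operations, closing maps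
`Λ_{w,j}` and distances. -/
structure LambdaStructure where
  /-- The carriers `A_i`. -/
  carrier : Ty → Type
  /-- The application operators. -/
  app : ∀ {i j : Ty}, carrier (Ty.arr i j) → carrier i → carrier j
  /-- The constant `⊥`. -/
  bot : carrier Ty.o
  /-- The closing maps, from closed terms of type `w → j` with constants in `A` to `A_{w → j}`. -/
  clos : ∀ (w : List Ty) (j : Ty), Term carrier [] (arrows w j) → carrier (arrows w j)
  /-- The distances. -/
  dist : ∀ i : Ty, carrier i → carrier i → ℝ≥0∞

namespace LambdaStructure

/-- The maximum distance on `A_w` (`0` if `w` is empty). -/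
def tupleDist (𝒜 : LambdaStructure) (w : List Ty) (a b : Tuple 𝒜.carrier w) : ℝ≥0∞ :=
  ⨆ (i : Ty) (k : Idx w i), 𝒜.dist i (a i k) (b i k)

/-- Iterated application `g · a₁ · … · aₙ`. -/
def apps (𝒜 : LambdaStructure) :
    ∀ (w : List Ty) (j : Ty), 𝒜.carrier (arrows w j) → Tuple 𝒜.carrier w → 𝒜.carrier j
  | [], _, g, _ => g
  | i :: w, j, g, a => 𝒜.app (𝒜.apps w (Ty.arr i j) g (fun _ k => a _ (Idx.succ k))) (a _ Idx.zero)

/-- The closed term `t` represents the function `f`: `f a = Λ(t) · a₁ · … · aₙ`. -/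
def Represents (𝒜 : LambdaStructure) {w : List Ty} {j : Ty} (t : Term 𝒜.carrier [] (arrows w j))
    (f : Tuple 𝒜.carrier w → 𝒜.carrier j) : Prop :=
  ∀ a, f a = 𝒜.apps w j (𝒜.clos w j t) a

/-- The multiarrows: non-expansive functions that are represented by some closed term. -/
def IsArrow (𝒜 : LambdaStructure) {w : List Ty} {j : Ty}
    (f : Tuple 𝒜.carrier w → 𝒜.carrier j) : Prop :=
  (∀ a b, 𝒜.dist j (f a) (f b) ≤ 𝒜.tupleDist w a b) ∧ ∃ t, 𝒜.Represents t f

/-- The set of multiarrows from `A_w` to `A_j`. -/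
def Hom (𝒜 : LambdaStructure) (w : List Ty) (j : Ty) : Type :=
  {f : Tuple 𝒜.carrier w → 𝒜.carrier j // 𝒜.IsArrow f}

/-- The distance `Ξ` on the set of multiarrows from `A_w` to `A_j`. -/
def homDist (𝒜 : LambdaStructure) {w : List Ty} {j : Ty} (f g : 𝒜.Hom w j) : ℝ≥0∞ :=
  xiDist (𝒜.tupleDist w) (𝒜.dist j) f.1 g.1

/-- Partial quantitative applicative algebras: every sort carries a partial ultrametric and every
symbol of the signature is interpreted by a non-expansive map. -/
structure IsPartialQuantitative (𝒜 : LambdaStructure) : Prop where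
  dist_partialUltrametric : ∀ i, IsPartialUltrametric (𝒜.dist i)
  app_nonexpansive : ∀ {i j : Ty} (f g : 𝒜.carrier (Ty.arr i j)) (a b : 𝒜.carrier i),
    𝒜.dist j (𝒜.app f a) (𝒜.app g b) ≤ max (𝒜.dist _ f g) (𝒜.dist i a b)
  bot_nonexpansive : 𝒜.dist Ty.o 𝒜.bot 𝒜.bot ≤ 0

/-- The multiarrows form a cartesian multicategory: they contain the projections and are closed
under composition. -/
structure IsMulticategory (𝒜 : LambdaStructure) : Prop where
  proj : ∀ {w : List Ty} {i : Ty} (k : Idx w i),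
    𝒜.IsArrow (fun a : Tuple 𝒜.carrier w => a i k)
  comp : ∀ {v w : List Ty} {j : Ty} (h : 𝒜.Hom w j) (g : ∀ i, Idx w i → 𝒜.Hom v i),
    𝒜.IsArrow (fun z : Tuple 𝒜.carrier v => h.1 (fun i k => (g i k).1 z))

/-- The maps `Λ` and `Ev` between the multiarrows `A_{w*i} → A_j` and `A_w → A_{i → j}` are
well-defined, mutually inverse, natural in `w`, and non-expansive for the distances `Ξ`. Here
`Λ(h)(a) = Λ_{w*i,j}(t) · a` for any closed term `t` that represents `h`, and
`Ev(f)(z, x) = f(z) · x`. -/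
structure IsExponential (𝒜 : LambdaStructure)
    (Lam : ∀ (w : List Ty) (i j : Ty), 𝒜.Hom (i :: w) j → 𝒜.Hom w (Ty.arr i j))
    (Ev : ∀ (w : List Ty) (i j : Ty), 𝒜.Hom w (Ty.arr i j) → 𝒜.Hom (i :: w) j) : Prop where
  lam_apply : ∀ (w : List Ty) (i j : Ty) (h : 𝒜.Hom (i :: w) j)
    (t : Term 𝒜.carrier [] (arrows (i :: w) j)), 𝒜.Represents t h.1 →
    ∀ a, (Lam w i j h).1 a = 𝒜.apps w (Ty.arr i j) (𝒜.clos (i :: w) j t) a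
  ev_apply : ∀ (w : List Ty) (i j : Ty) (f : 𝒜.Hom w (Ty.arr i j)) (z : Tuple 𝒜.carrier w)
    (x : 𝒜.carrier i), (Ev w i j f).1 (z.snoc x) = 𝒜.app (f.1 z) x
  ev_lam : ∀ (w : List Ty) (i j : Ty) (h : 𝒜.Hom (i :: w) j), Ev w i j (Lam w i j h) = h
  lam_ev : ∀ (w : List Ty) (i j : Ty) (f : 𝒜.Hom w (Ty.arr i j)), Lam w i j (Ev w i j f) = f
  lam_natural : ∀ (v w : List Ty) (i j : Ty) (g : ∀ k, Idx w k → 𝒜.Hom v k)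
    (h : 𝒜.Hom (i :: w) j) (h' : 𝒜.Hom (i :: v) j),
    (∀ z x, h'.1 (Tuple.snoc z x) = h.1 (Tuple.snoc (fun k n => (g k n).1 z) x)) →
    ∀ z, (Lam v i j h').1 z = (Lam w i j h).1 (fun k n => (g k n).1 z)
  ev_natural : ∀ (v w : List Ty) (i j : Ty) (g : ∀ k, Idx w k → 𝒜.Hom v k)
    (f : 𝒜.Hom w (Ty.arr i j)) (f' : 𝒜.Hom v (Ty.arr i j)),
    (∀ z, f'.1 z = f.1 (fun k n => (g k n).1 z)) →
    ∀ z x, (Ev v i j f').1 (Tuple.snoc z x) =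
      (Ev w i j f).1 (Tuple.snoc (fun k n => (g k n).1 z) x)
  lam_nonexpansive : ∀ (w : List Ty) (i j : Ty) (h h' : 𝒜.Hom (i :: w) j),
    𝒜.homDist (Lam w i j h) (Lam w i j h') ≤ 𝒜.homDist h h'
  ev_nonexpansive : ∀ (w : List Ty) (i j : Ty) (f f' : 𝒜.Hom w (Ty.arr i j)),
    𝒜.homDist (Ev w i j f) (Ev w i j f') ≤ 𝒜.homDist f f'

/-- Partial quantitative extensional lambda-algebras. -/
structure IsPartialQuantitativeExtensionalLambdaAlgebra (𝒜 : LambdaStructure) : Prop where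
  quantitative : 𝒜.IsPartialQuantitative
  multicategory : 𝒜.IsMulticategory
  exponential : ∃ Lam Ev, 𝒜.IsExponential Lam Ev

end LambdaStructure

/-- The structure on the normal forms. A closed term with normal forms as constants is sent to the
normal form of the term obtained by reading each constant as the term that it is. -/
def NFAlgebra : LambdaStructure where
  carrier := NF
  app := NF.app
  bot := Nf.bot
  clos := fun _ _ t => normalForm (Term.substPar (fun _ u => Nf.toTerm u) t)
  dist := fun σ t s => (dNF σ t s : ℝ≥0∞)

end STLC

end

/-!
Every term has exactly one long normal form, and application of normal forms is extensional:
`t · s = t' · s` for all `s` forces `t = t'` (`NF.ext_app`), since `s` may be a variable that is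
fresh for `t` and `t'`. This has a strong consequence for the distance: it is discrete at every
type (`dNF_eq_ite`). Indeed, if `dNF` is discrete at `σ` and at `τ`, then for `n > 0` the condition
that arguments at distance at most `2⁻ⁿ` are sent to values at distance at most `2⁻ⁿ` says that `t`
and `t'` agree on every argument. So an `n > 0` satisfies the two conditions that define
`dNF (σ → τ) t t'` only if `t = t'`, in which case every `n` does. The metric part of the theorem
follows: discrete distances are ultrametrics, all maps between discrete spaces are non-expansive,
and maps between sets of arrows are non-expansive for `Ξ` as soon as they are functions
(`NFAlgebra_homDist_le`).

Existence of normal forms (`exists_betaEta_toTerm`) is proved with a Kripke logical relation,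
`Computable`. Uniqueness (`Nf.eq_of_betaEta`) comes from normalization by evaluation in the full
set-theoretic type hierarchy `Sem` over `ℕ → NfCode o`: convertible terms have equal values
(`BetaEta.eval_eq`), and the code of a normal form can be read off from its value
(`Nf.reify_eval`). Extensionality uses the same model: the value of a fresh variable there can be
chosen arbitrarily, so the values of `t` and `t'` are equal as functions.

For the algebraic part, the functions represented by closed terms with constants in the algebra are
those given by substitution into an open term (`isArrow_iff_isDefinable`). Projections, composites
and uncurried functions are visibly of this form, and by extensionality `Λ(h)(a)` is determined by
`Λ(h)(a) · x = h(a, x)`, which makes `Λ` well-defined, natural and inverse to `Ev`.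
-/

namespace STLC

/-! ### Renaming and substitution -/

namespace Term

variable {V : Ty → Type} {Γ Δ Θ : List Ty} {σ τ κ : Ty}

theorem rename_rename (r : ∀ σ, Idx Γ σ → Idx Δ σ) (r' : ∀ σ, Idx Δ σ → Idx Θ σ)
    (t : Term V Γ σ) : rename r' (rename r t) = rename (fun _ k => r' _ (r _ k)) t := by
  induction t generalizing Δ Θ with
  | lam t ih =>
    simp only [rename, ih]
    congr 2
    funext σ k
    cases k <;> rfl
  | _ => simp_all [rename]

theorem subst_rename (r : ∀ σ, Idx Γ σ → Idx Δ σ) (f : ∀ σ, Idx Δ σ → Term V Θ σ)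
    (t : Term V Γ σ) : subst f (rename r t) = subst (fun _ k => f _ (r _ k)) t := by
  induction t generalizing Δ Θ with
  | lam t ih =>
    simp only [rename, subst, ih]
    congr 2
    funext σ k
    cases k <;> rfl
  | _ => simp_all [rename, subst]

theorem rename_weaken (r : ∀ σ, Idx Γ σ → Idx Δ σ) (t : Term V Γ σ) :
    rename (liftRen r κ) (weaken κ t) = weaken κ (rename r t) := by
  simp only [weaken, rename_rename]
  rfl

theorem rename_subst (f : ∀ σ, Idx Γ σ → Term V Δ σ) (r : ∀ σ, Idx Δ σ → Idx Θ σ)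
    (t : Term V Γ σ) : rename r (subst f t) = subst (fun _ k => rename r (f _ k)) t := by
  induction t generalizing Δ Θ with
  | lam t ih =>
    simp only [rename, subst, ih]
    congr 2
    funext σ k
    cases k
    · rfl
    · exact rename_weaken r _
  | _ => simp_all [rename, subst]

theorem subst_weaken (f : ∀ σ, Idx Γ σ → Term V Δ σ) (t : Term V Γ σ) :
    subst (liftSub f κ) (weaken κ t) = weaken κ (subst f t) := by
  simp only [weaken, rename_subst, subst_rename]
  rfl

theorem subst_subst (f : ∀ σ, Idx Γ σ → Term V Δ σ) (g : ∀ σ, Idx Δ σ → Term V Θ σ)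
    (t : Term V Γ σ) : subst g (subst f t) = subst (fun _ k => subst g (f _ k)) t := by
  induction t generalizing Δ Θ with
  | lam t ih =>
    simp only [subst, ih]
    congr 2
    funext σ k
    cases k
    · rfl
    · exact subst_weaken g _
  | _ => simp_all [subst]

theorem rename_eq_subst (r : ∀ σ, Idx Γ σ → Idx Δ σ) (t : Term V Γ σ) :
    rename r t = subst (fun _ k => bvar (r _ k)) t := by
  induction t generalizing Δ with
  | lam t ih =>
    simp only [rename, subst, ih]
    congr 2
    funext σ k
    cases k <;> rfl
  | _ => simp_all [rename, subst]

theorem subst_bvar (t : Term V Γ σ) : subst (fun _ k => bvar k) t = t := by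
  induction t with
  | @lam Γ κ τ t ih =>
    have h : liftSub (V := V) (fun _ (k : Idx Γ _) => bvar k) κ = fun _ k => bvar k := by
      funext σ k
      cases k <;> rfl
    simp only [subst, h, ih]
  | _ => simp_all [subst]

theorem inst_subst_liftSub (f : ∀ σ, Idx Γ σ → Term V Δ σ) (t : Term V (κ :: Γ) σ)
    (s : Term V Δ κ) :
    inst (subst (liftSub f κ) t) s = subst (Tuple.snoc (A := Term V Δ) f s) t := by
  rw [inst, subst_subst]
  congr 1
  funext σ k
  cases k with
  | zero => rfl
  | succ k => exact (subst_rename _ _ _).trans (subst_bvar _)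

theorem rename_inst (r : ∀ σ, Idx Γ σ → Idx Δ σ) (t : Term V (κ :: Γ) σ) (s : Term V Γ κ) :
    rename r (inst t s) = inst (rename (liftRen r κ) t) (rename r s) := by
  rw [inst, inst, rename_subst, subst_rename]
  congr 1
  funext σ k
  cases k <;> rfl

end Term

namespace BetaEta

variable {V : Ty → Type} {Γ Δ : List Ty} {σ : Ty}

theorem rename {t t' : Term V Γ σ} (h : BetaEta t t') (r : ∀ σ, Idx Γ σ → Idx Δ σ) :
    BetaEta (t.rename r) (t'.rename r) := by
  induction h generalizing Δ with
  | beta t s =>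
    rw [Term.rename_inst]
    exact .beta _ _
  | eta t =>
    simp only [Term.rename, Term.rename_weaken]
    exact .eta _
  | app _ _ ih ih' => exact .app (ih r) (ih' r)
  | lam _ ih => exact .lam (ih _)
  | refl => exact .refl _
  | symm _ ih => exact .symm (ih r)
  | trans _ _ ih ih' => exact .trans (ih r) (ih' r)

theorem subst_congr {f g : ∀ σ, Idx Γ σ → Term V Δ σ} (h : ∀ σ k, BetaEta (f σ k) (g σ k))
    (t : Term V Γ σ) : BetaEta (t.subst f) (t.subst g) := by
  induction t generalizing Δ with
  | bvar k => exact h _ k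
  | app _ _ ih ih' => exact .app (ih h) (ih' h)
  | lam t ih =>
    refine .lam (ih fun σ k => ?_)
    cases k with
    | zero => exact .refl _
    | succ k => exact (h _ k).rename _
  | _ => exact .refl _

end BetaEta

/-! ### Existence of normal forms -/

mutual

/-- Renaming of indices in a normal form. -/
def Nf.rename : ∀ {Γ Δ : List Ty} {σ : Ty}, (∀ σ, Idx Γ σ → Idx Δ σ) → Nf Γ σ → Nf Δ σ
  | _, _, _, r, .lam t => .lam (t.rename (Term.liftRen r _))
  | _, _, _, _, .bot => .bot
  | _, _, _, r, .ne u => .ne (u.rename r)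

/-- Renaming of indices in `x t₁ … tₖ`. -/
def Ne.rename : ∀ {Γ Δ : List Ty} {σ : Ty}, (∀ σ, Idx Γ σ → Idx Δ σ) → Ne Γ σ → Ne Δ σ
  | _, _, _, _, .free x => .free x
  | _, _, _, r, .bvar k => .bvar (r _ k)
  | _, _, _, r, .app u t => .app (u.rename r) (t.rename r)

end

mutual

theorem Nf.toTerm_rename : ∀ {Γ Δ : List Ty} {σ : Ty} (r : ∀ σ, Idx Γ σ → Idx Δ σ) (t : Nf Γ σ),
    (t.rename r).toTerm = t.toTerm.rename r
  | _, _, _, r, .lam t => by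
    simp only [Nf.rename, Nf.toTerm, Term.rename, Nf.toTerm_rename _ t]
  | _, _, _, _, .bot => by simp only [Nf.rename, Nf.toTerm, Term.rename]
  | _, _, _, r, .ne u => by simp only [Nf.rename, Nf.toTerm, Ne.toTerm_rename r u]

theorem Ne.toTerm_rename : ∀ {Γ Δ : List Ty} {σ : Ty} (r : ∀ σ, Idx Γ σ → Idx Δ σ) (u : Ne Γ σ),
    (u.rename r).toTerm = u.toTerm.rename r
  | _, _, _, _, .free x => by simp only [Ne.rename, Ne.toTerm, Term.rename]
  | _, _, _, _, .bvar k => by simp only [Ne.rename, Ne.toTerm, Term.rename]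
  | _, _, _, r, .app u t => by
    simp only [Ne.rename, Ne.toTerm, Term.rename, Ne.toTerm_rename r u, Nf.toTerm_rename r t]

end

/-- Computable terms: at type `o` those with a normal form, at type `σ → τ` those that send
computable terms to computable terms in every context to which they can be renamed. -/
def Computable : ∀ (σ : Ty) {Γ : List Ty}, Term Var Γ σ → Prop
  | .o, Γ, t => ∃ u : Nf Γ .o, BetaEta t u.toTerm
  | .arr σ τ, Γ, t => ∀ (Δ : List Ty) (r : ∀ σ, Idx Γ σ → Idx Δ σ) (s : Term Var Δ σ),
      Computable σ s → Computable τ (Term.app (t.rename r) s)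

namespace Computable

theorem of_betaEta : ∀ (σ : Ty) {Γ : List Ty} {t t' : Term Var Γ σ}, BetaEta t t' →
    Computable σ t' → Computable σ t
  | .o, _, _, _, h, ⟨u, hu⟩ => ⟨u, h.trans hu⟩
  | .arr _ τ, _, _, _, h, ht => fun Δ r s hs =>
      of_betaEta τ (.app (h.rename r) (.refl s)) (ht Δ r s hs)

theorem rename : ∀ (σ : Ty) {Γ Δ : List Ty} {t : Term Var Γ σ} (r : ∀ σ, Idx Γ σ → Idx Δ σ),
    Computable σ t → Computable σ (t.rename r)
  | .o, _, _, _, r, ⟨u, hu⟩ => ⟨u.rename r, by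
      rw [Nf.toTerm_rename]
      exact hu.rename r⟩
  | .arr _ _, _, _, _, r, ht => fun Θ r' s hs => by
      rw [Term.rename_rename]
      exact ht Θ _ s hs

mutual

/-- Computability at `σ → τ` is tested on a new index; eta-conversion does the rest. -/
theorem exists_nf : ∀ (σ : Ty) {Γ : List Ty} {t : Term Var Γ σ}, Computable σ t →
    ∃ u : Nf Γ σ, BetaEta t u.toTerm
  | .o, _, _, ht => ht
  | .arr σ τ, Γ, t, ht => by
    have h0 := neutral σ (.bvar (Γ := σ :: Γ) .zero)
    rw [Ne.toTerm] at h0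
    obtain ⟨u, hu⟩ := exists_nf τ (ht (σ :: Γ) (fun _ k => .succ k) _ h0)
    refine ⟨.lam u, (BetaEta.eta t).symm.trans ?_⟩
    rw [Nf.toTerm]
    exact .lam hu

/-- A variable applied to normal forms is computable; in particular every variable is. -/
theorem neutral : ∀ (σ : Ty) {Γ : List Ty} (u : Ne Γ σ), Computable σ u.toTerm
  | .o, _, u => ⟨.ne u, by rw [Nf.toTerm]; exact .refl _⟩
  | .arr σ τ, _, u => fun Δ r s hs => by
    obtain ⟨v, hv⟩ := exists_nf σ hs
    refine of_betaEta τ ?_ (neutral τ (.app (u.rename r) v))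
    rw [Ne.toTerm, Ne.toTerm_rename]
    exact .app (.refl _) hv

end

/-- The fundamental lemma: computable substitutions turn every term into a computable one. -/
theorem subst {Γ Δ : List Ty} {σ : Ty} (t : Term Var Γ σ) (f : ∀ σ, Idx Γ σ → Term Var Δ σ)
    (hf : ∀ σ k, Computable σ (f σ k)) : Computable σ (t.subst f) := by
  induction t generalizing Δ with
  | bot => exact ⟨.bot, by rw [Nf.toTerm]; exact .refl _⟩
  | par x =>
    have h := neutral _ (Ne.free (Γ := Δ) x)
    rwa [Ne.toTerm] at h
  | bvar k => exact hf _ k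
  | app t s iht ihs =>
    have h := iht f hf Δ (fun _ k => k) _ (ihs f hf)
    rwa [Term.rename_eq_subst, Term.subst_bvar] at h
  | @lam Γ σ τ t ih =>
    intro Θ r s hs
    have h := ih (Tuple.snoc (A := Term Var Θ) (fun σ k => (f σ k).rename r) s) fun σ k => by
      cases k with
      | zero => exact hs
      | succ k => exact (hf _ k).rename _ r
    rw [← Term.inst_subst_liftSub] at h
    rw [Term.rename_subst]
    exact of_betaEta τ (.beta _ _) h

end Computable

theorem exists_betaEta_toTerm {Γ : List Ty} {σ : Ty} (t : Term Var Γ σ) :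
    ∃ u : Nf Γ σ, BetaEta t u.toTerm := by
  have h := Computable.subst t (fun _ k => .bvar k) fun σ k => by
    have h := Computable.neutral σ (.bvar k)
    rwa [Ne.toTerm] at h
  rw [Term.subst_bvar] at h
  exact h.exists_nf

theorem betaEta_normalForm {σ : Ty} (t : Term Var [] σ) : BetaEta t (normalForm t).toTerm :=
  Classical.epsilon_spec (exists_betaEta_toTerm t)

/-! ### A full set-theoretic model and uniqueness of normal forms -/

mutual

/-- Codes of normal forms, in which a bound variable is written as its level: a natural number
chosen when the binder is crossed, which does not change under further binders. -/
inductive NfCode : Ty → Type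
  | lam {σ τ : Ty} : NfCode τ → NfCode (Ty.arr σ τ)
  | bot : NfCode Ty.o
  | ne : NeCode Ty.o → NfCode Ty.o

/-- Codes of variables applied to normal forms. -/
inductive NeCode : Ty → Type
  | free {σ : Ty} : Var σ → NeCode σ
  | level {σ : Ty} : ℕ → NeCode σ
  | app {σ τ : Ty} : NeCode (Ty.arr σ τ) → NfCode σ → NeCode τ

end

mutual

/-- The code of a normal form, given levels `ℓ` of the unbound indices; the binders get the levels
`n`, `n + 1`, … from the outside to the inside. -/
def Nf.code : ∀ {Γ : List Ty} {σ : Ty}, Tuple (fun _ => ℕ) Γ → ℕ → Nf Γ σ → NfCode σ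
  | _, _, ℓ, n, .lam t => .lam (t.code (ℓ.snoc n) (n + 1))
  | _, _, _, _, .bot => .bot
  | _, _, ℓ, n, .ne u => .ne (u.code ℓ n)

/-- The code of `x t₁ … tₖ`. -/
def Ne.code : ∀ {Γ : List Ty} {σ : Ty}, Tuple (fun _ => ℕ) Γ → ℕ → Ne Γ σ → NeCode σ
  | _, _, _, _, .free x => .free x
  | _, _, ℓ, _, .bvar k => .level (ℓ _ k)
  | _, _, ℓ, n, .app u t => .app (u.code ℓ n) (t.code ℓ n)

end

/-- Levels below `n` that distinguish the indices of equal type. -/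
def IsLeveling {Γ : List Ty} (ℓ : Tuple (fun _ => ℕ) Γ) (n : ℕ) : Prop :=
  (∀ σ k, ℓ σ k < n) ∧ ∀ σ k k', ℓ σ k = ℓ σ k' → k = k'

theorem IsLeveling.snoc {Γ : List Ty} {ℓ : Tuple (fun _ => ℕ) Γ} {n : ℕ} (h : IsLeveling ℓ n)
    (κ : Ty) : IsLeveling (ℓ.snoc (i := κ) n) (n + 1) := by
  refine ⟨fun σ k => ?_, fun σ k k' hk => ?_⟩
  · cases k with
    | zero => exact Nat.lt_succ_self n
    | succ k => exact Nat.lt_succ_of_lt (h.1 _ k)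
  · cases k with
    | zero =>
      cases k' with
      | zero => rfl
      | succ k' => exact absurd hk (h.1 _ k').ne'
    | succ k =>
      cases k' with
      | zero => exact absurd hk (h.1 _ k).ne
      | succ k' => exact congrArg _ (h.2 _ _ _ hk)

mutual

theorem Nf.code_injective : ∀ {Γ : List Ty} {σ : Ty} {ℓ : Tuple (fun _ => ℕ) Γ} {n : ℕ},
    IsLeveling ℓ n → ∀ t t' : Nf Γ σ, t.code ℓ n = t'.code ℓ n → t = t'
  | _, _, _, _, hℓ, .lam t, .lam t', h => by
    simp only [Nf.code, NfCode.lam.injEq] at h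
    rw [Nf.code_injective (hℓ.snoc _) t t' h]
  | _, _, _, _, _, .bot, .bot, _ => rfl
  | _, _, _, _, _, .bot, .ne _, h => by simp [Nf.code] at h
  | _, _, _, _, _, .ne _, .bot, h => by simp [Nf.code] at h
  | _, _, _, _, hℓ, .ne u, .ne u', h => by
    simp only [Nf.code, NfCode.ne.injEq] at h
    rw [Ne.code_injective hℓ u u' h]

theorem Ne.code_injective : ∀ {Γ : List Ty} {σ : Ty} {ℓ : Tuple (fun _ => ℕ) Γ} {n : ℕ},
    IsLeveling ℓ n → ∀ u u' : Ne Γ σ, u.code ℓ n = u'.code ℓ n → u = u'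
  | _, _, _, _, hℓ, .app u t, u', h => by
    cases u' with
    | app u' t' =>
      simp only [Ne.code, NeCode.app.injEq] at h
      obtain ⟨rfl, h, h'⟩ := h
      rw [Ne.code_injective hℓ u u' (eq_of_heq h), Nf.code_injective hℓ t t' (eq_of_heq h')]
    | _ => simp [Ne.code] at h
  | _, _, _, _, _, .free x, u', h => by
    cases u' with
    | free => simpa [Ne.code] using h
    | _ => simp [Ne.code] at h
  | _, _, _, _, hℓ, .bvar k, u', h => by
    cases u' with
    | bvar k' =>
      simp only [Ne.code, NeCode.level.injEq] at h
      rw [hℓ.2 _ _ _ h]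
    | _ => simp [Ne.code] at h

end

/-- The full type hierarchy over the functions from `ℕ` to codes. The argument in `ℕ` is the first
level that is not in use. -/
def Sem : Ty → Type
  | .o => ℕ → NfCode .o
  | .arr σ τ => Sem σ → Sem τ

/-- The value of a term in the full type hierarchy. -/
def Term.eval {V : Ty → Type} (ρ : ∀ σ, V σ → Sem σ) :
    ∀ {Γ : List Ty} {σ : Ty}, Term V Γ σ → Tuple Sem Γ → Sem σ
  | _, _, .bot, _ => fun _ => .bot
  | _, _, .par x, _ => ρ _ x
  | _, _, .bvar k, γ => γ _ k
  | _, _, .app t s, γ => (t.eval ρ γ) (s.eval ρ γ)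
  | _, _, .lam t, γ => fun a => t.eval ρ (γ.snoc a)

section Eval

variable {V : Ty → Type} {Γ Δ : List Ty} {σ : Ty} (ρ : ∀ σ, V σ → Sem σ)

theorem Term.eval_rename (r : ∀ σ, Idx Γ σ → Idx Δ σ) (t : Term V Γ σ) (γ : Tuple Sem Δ) :
    (t.rename r).eval ρ γ = t.eval ρ fun _ k => γ _ (r _ k) := by
  induction t generalizing Δ with
  | lam t ih =>
    simp only [Term.rename, Term.eval, ih]
    funext a
    congr 1
    funext σ k
    cases k <;> rfl
  | bot => rfl
  | _ => simp_all [Term.rename, Term.eval]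

theorem Term.eval_subst (f : ∀ σ, Idx Γ σ → Term V Δ σ) (t : Term V Γ σ) (γ : Tuple Sem Δ) :
    (t.subst f).eval ρ γ = t.eval ρ fun _ k => (f _ k).eval ρ γ := by
  induction t generalizing Δ with
  | lam t ih =>
    simp only [Term.subst, Term.eval, ih]
    funext a
    congr 1
    funext σ k
    cases k with
    | zero => rfl
    | succ k => exact Term.eval_rename ρ _ _ _
  | bot => rfl
  | _ => simp_all [Term.subst, Term.eval]

theorem BetaEta.eval_eq {t t' : Term V Γ σ} (h : BetaEta t t') (γ : Tuple Sem Γ) :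
    t.eval ρ γ = t'.eval ρ γ := by
  induction h with
  | beta t s =>
    simp only [Term.inst, Term.eval_subst, Term.eval]
    congr 1
    funext σ k
    cases k <;> rfl
  | eta t =>
    simp only [Term.eval, Term.weaken, Term.eval_rename]
    rfl
  | app _ _ ih ih' => simp only [Term.eval, ih, ih']
  | lam _ ih => exact funext fun a => ih _
  | refl => rfl
  | symm _ ih => exact (ih γ).symm
  | trans _ _ ih ih' => exact (ih γ).trans (ih' γ)

end Eval

mutual

/-- The code of an element of the model, computed by applying it to fresh levels. -/
def reify : ∀ σ : Ty, Sem σ → ℕ → NfCode σ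
  | .o, a, n => a n
  | .arr σ τ, a, n => .lam (reify τ (a (reflect σ fun _ => .level n)) (n + 1))

/-- The element of the model that extends a code `x t₁ … tₖ` by the codes of its arguments. -/
def reflect : ∀ σ : Ty, (ℕ → NeCode σ) → Sem σ
  | .o, u => fun n => .ne (u n)
  | .arr σ τ, u => fun a => reflect τ fun n => .app (u n) (reify σ a n)

end

/-- Free variables as elements of the model. -/
def freeEnv (σ : Ty) (x : Var σ) : Sem σ := reflect σ fun _ => .free x

mutual

/-- Evaluation loses nothing: the code of a normal form can be read off from its value. -/
theorem Nf.reify_eval : ∀ {Γ : List Ty} {σ : Ty} (t : Nf Γ σ) (ℓ : Tuple (fun _ => ℕ) Γ) (n : ℕ),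
    reify σ (t.toTerm.eval freeEnv fun σ k => reflect σ fun _ => .level (ℓ σ k)) n = t.code ℓ n
  | Γ, _, .lam (σ := σ) t, ℓ, n => by
    have h : (Tuple.snoc (A := Sem) (fun σ (k : Idx Γ σ) => reflect σ fun _ => .level (ℓ σ k))
        (reflect σ fun _ => .level n)) =
        fun σ' k => reflect σ' fun _ => .level (ℓ.snoc (i := σ) n σ' k) := by
      funext σ k
      cases k <;> rfl
    simp only [Nf.toTerm, Nf.code, Term.eval, reify, h, Nf.reify_eval t]
  | _, _, .bot, _, _ => by simp only [Nf.toTerm, Nf.code, Term.eval, reify]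
  | _, _, .ne u, ℓ, n => by simp only [Nf.toTerm, Nf.code, Ne.eval_eq_reflect u, reify, reflect]

theorem Ne.eval_eq_reflect : ∀ {Γ : List Ty} {σ : Ty} (u : Ne Γ σ) (ℓ : Tuple (fun _ => ℕ) Γ),
    (u.toTerm.eval freeEnv fun σ k => reflect σ fun _ => .level (ℓ σ k)) =
      reflect σ fun n => u.code ℓ n
  | _, _, .free x, _ => by simp only [Ne.toTerm, Ne.code, Term.eval, freeEnv]
  | _, _, .bvar k, _ => by simp only [Ne.toTerm, Ne.code, Term.eval]
  | _, _, .app u t, ℓ => by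
    simp only [Ne.toTerm, Ne.code, Term.eval, Ne.eval_eq_reflect u, reflect, Nf.reify_eval t]

end

theorem Nf.eq_of_eval_eq {σ : Ty} {t t' : NF σ}
    (h : ∀ γ, t.toTerm.eval freeEnv γ = t'.toTerm.eval freeEnv γ) : t = t' := by
  have hℓ : IsLeveling (Γ := []) (fun _ k => nomatch k) 0 :=
    ⟨fun _ k => (nomatch k), fun _ k => (nomatch k)⟩
  refine Nf.code_injective hℓ t t' ?_
  rw [← Nf.reify_eval, ← Nf.reify_eval, h]

theorem Nf.eq_of_betaEta {σ : Ty} {t t' : NF σ} (h : BetaEta t.toTerm t'.toTerm) : t = t' :=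
  Nf.eq_of_eval_eq fun γ => h.eval_eq _ γ

/-! ### Application of normal forms is extensional -/

/-- A term has only finitely many parameters. -/
theorem Term.exists_eval_eq_of_eq_below {Γ : List Ty} {σ : Ty} (t : Term Var Γ σ) :
    ∃ N : ℕ, ∀ ρ ρ' : ∀ σ, Var σ → Sem σ, (∀ σ (n : ℕ), n < N → ρ σ n = ρ' σ n) →
      ∀ γ, t.eval ρ γ = t.eval ρ' γ := by
  induction t with
  | par x => exact ⟨Nat.succ x, fun ρ ρ' h γ => h _ x (Nat.lt_succ_self x)⟩
  | app t s iht ihs =>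
    obtain ⟨N, hN⟩ := iht
    obtain ⟨M, hM⟩ := ihs
    refine ⟨max N M, fun ρ ρ' h γ => ?_⟩
    simp only [Term.eval]
    rw [hN ρ ρ' (fun σ n hn => h σ n (lt_max_of_lt_left hn)),
      hM ρ ρ' (fun σ n hn => h σ n (lt_max_of_lt_right hn))]
  | lam t ih =>
    obtain ⟨N, hN⟩ := ih
    exact ⟨N, fun ρ ρ' h γ => funext fun a => hN ρ ρ' h _⟩
  | _ => exact ⟨0, fun _ _ _ _ => rfl⟩

theorem NF.betaEta_app {σ τ : Ty} (t : NF (Ty.arr σ τ)) (s : NF σ) :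
    BetaEta (Term.app t.toTerm s.toTerm) (t.app s).toTerm :=
  betaEta_normalForm _

/-- Normal forms that agree on all arguments are equal, since they agree on a variable `x` that
is fresh for both: the value of `x` in the model can be chosen at will. -/
theorem NF.ext_app {σ τ : Ty} {t t' : NF (Ty.arr σ τ)} (h : ∀ s, t.app s = t'.app s) : t = t' := by
  classical
  obtain ⟨N, hN⟩ := t.toTerm.exists_eval_eq_of_eq_below
  obtain ⟨M, hM⟩ := t'.toTerm.exists_eval_eq_of_eq_below
  let x : Var σ := (max N M : ℕ)
  obtain ⟨s, hs⟩ := exists_betaEta_toTerm (Γ := []) (Term.par x)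
  have hx : BetaEta (Term.app t.toTerm (Term.par x)) (Term.app t'.toTerm (Term.par x)) := by
    refine (BetaEta.app (.refl _) hs).trans (.trans ?_ (BetaEta.app (.refl _) hs.symm))
    refine (t.betaEta_app s).trans ?_
    rw [h s]
    exact (t'.betaEta_app s).symm
  refine Nf.eq_of_eval_eq fun γ => funext fun a => ?_
  -- `ρ` differs from `freeEnv` only at `x`, where its value is `a`.
  let ρ : ∀ σ, Var σ → Sem σ := fun κ => if e : σ = κ then
    Function.update (freeEnv κ) (e ▸ x) (e ▸ a) else freeEnv κ
  have hρ : ∀ κ (n : ℕ), n < max N M → freeEnv κ n = ρ κ n := by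
    intro κ n hn
    by_cases e : σ = κ
    · subst e
      simp only [ρ, dif_pos]
      exact (@Function.update_of_ne (Var σ) _ _ n x hn.ne _ _).symm
    · simp only [ρ, dif_neg e]
  have hρx : ρ σ x = a := by simp [ρ]
  have key := hx.eval_eq ρ γ
  simp only [Term.eval, hρx] at key
  rwa [hN freeEnv ρ fun κ n hn => hρ κ n (lt_max_of_lt_left hn),
    hM freeEnv ρ fun κ n hn => hρ κ n (lt_max_of_lt_right hn)]

/-! ### The distance on normal forms -/

theorem Nf.approx_zero_eq : ∀ {Γ : List Ty} {σ : Ty} (t t' : Nf Γ σ), t.approx 0 = t'.approx 0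
  | _, _, .lam t, .lam t' => by simp only [Nf.approx, Nf.approx_zero_eq t t']
  | _, _, .bot, .bot => rfl
  | _, _, .bot, .ne _ => by simp only [Nf.approx]
  | _, _, .ne _, .bot => by simp only [Nf.approx]
  | _, _, .ne _, .ne _ => by simp only [Nf.approx]

open Classical in
/-- The distance is discrete at every type. If `n > 0` satisfies the two conditions that define
`dNF (σ → τ) t t'`, then inductively `t` and `t'` agree on every argument, so they are equal. -/
theorem dNF_eq_ite : ∀ (σ : Ty) (t t' : NF σ), dNF σ t t' = if t = t' then 0 else 1
  | .o, t, t' => by simp only [dNF]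
  | .arr σ τ, t, t' => by
    rw [dNF]
    split_ifs with h e e
    · -- If `t = t'`, every `n` satisfies both conditions, so there is no largest one.
      exfalso
      subst e
      obtain ⟨m, -, hm⟩ := h
      refine absurd (hm ⟨rfl, fun s s' hs => ?_⟩) (Nat.not_succ_le_self m)
      rw [dNF_eq_ite σ] at hs
      split_ifs at hs with e
      · simp [dNF_eq_ite τ, e]
      · exact absurd hs (not_le.2 (by
          rw [one_div]; exact inv_lt_one_of_one_lt₀ (one_lt_pow₀ one_lt_two m.succ_ne_zero)))
    · suffices h.choose = 0 by rw [this]; simp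
      by_contra hn
      refine e (NF.ext_app fun s => ?_)
      have hs := h.choose_spec.1.2 s s (by simp [dNF_eq_ite σ])
      by_contra hne
      rw [dNF_eq_ite τ, if_neg hne] at hs
      exact absurd hs (not_le.2 (by
        rw [one_div]; exact inv_lt_one_of_one_lt₀ (one_lt_pow₀ one_lt_two hn)))
    · rfl
    · -- If `t ≠ t'`, the largest `n` that satisfies both conditions is `0`.
      refine absurd ⟨0, ⟨t.approx_zero_eq t', fun s s' _ => ?_⟩, fun n hn => ?_⟩ h
      · rw [dNF_eq_ite τ]
        split_ifs <;> simp
      · by_contra hn0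
        refine e (NF.ext_app fun s => ?_)
        have hs := hn.2 s s (by simp [dNF_eq_ite σ])
        by_contra hne
        rw [dNF_eq_ite τ, if_neg hne] at hs
        exact absurd hs (not_le.2 (by
          rw [one_div]
          exact inv_lt_one_of_one_lt₀ (one_lt_pow₀ one_lt_two fun h0 => hn0 h0.le)))

/-! ### The algebra of normal forms -/

theorem NFAlgebra_dist_eq_zero {i : Ty} (x : NF i) : NFAlgebra.dist i x x = 0 := by
  simp [NFAlgebra, dNF_eq_ite]

theorem NFAlgebra_dist_eq_one {i : Ty} {x y : NF i} (h : x ≠ y) : NFAlgebra.dist i x y = 1 := by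
  simp [NFAlgebra, dNF_eq_ite, h]

theorem NFAlgebra_dist_le_one {i : Ty} (x y : NF i) : NFAlgebra.dist i x y ≤ 1 := by
  by_cases h : x = y
  · simp [h, NFAlgebra_dist_eq_zero]
  · rw [NFAlgebra_dist_eq_one h]

theorem isPartialUltrametric_dNF (σ : Ty) :
    IsPartialUltrametric (fun t s : NF σ => (dNF σ t s : ℝ≥0∞)) where
  symm x y := by
    by_cases h : x = y
    · rw [h]
    · simp only [dNF_eq_ite, if_neg h, if_neg (Ne.symm h)]
  trans x y z := by
    by_cases h : x = z
    · subst h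
      exact le_max_right _ _
    · refine le_max_of_le_left ?_
      simp only [dNF_eq_ite, if_neg h]
      split_ifs <;> simp
  refl_left x y := by simp [dNF_eq_ite]
  refl_right x y := by simp [dNF_eq_ite]

theorem dNF_app_le {σ τ : Ty} (t t' : NF (Ty.arr σ τ)) (s s' : NF σ) :
    dNF τ (t.app s) (t'.app s') ≤ max (dNF (Ty.arr σ τ) t t') (dNF σ s s') := by
  by_cases h : t = t' ∧ s = s'
  · simp [dNF_eq_ite, h.1, h.2]
  · have h1 : dNF τ (t.app s) (t'.app s') ≤ 1 := by
      rw [dNF_eq_ite]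
      split_ifs <;> simp
    rcases not_and_or.1 h with h | h
    · exact le_max_of_le_left (by rwa [dNF_eq_ite _ t, if_neg h])
    · exact le_max_of_le_right (by rwa [dNF_eq_ite _ s, if_neg h])

theorem NFAlgebra_tupleDist_eq_zero {w : List Ty} (a : Tuple NF w) :
    NFAlgebra.tupleDist w a a = 0 := by
  simp [LambdaStructure.tupleDist, NFAlgebra_dist_eq_zero]

/-- Every function on a product of discrete spaces is non-expansive. -/
theorem NFAlgebra_dist_le_tupleDist {w : List Ty} {j : Ty} (f : Tuple NF w → NF j)
    (a b : Tuple NF w) : NFAlgebra.dist j (f a) (f b) ≤ NFAlgebra.tupleDist w a b := by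
  by_cases h : a = b
  · simp [h, NFAlgebra_dist_eq_zero]
  · have : ∃ i k, a i k ≠ b i k := by
      by_contra! hab
      exact h (funext fun i => funext fun k => hab i k)
    obtain ⟨i, k, hk⟩ := this
    refine (NFAlgebra_dist_le_one _ _).trans ?_
    rw [← NFAlgebra_dist_eq_one hk]
    exact le_iSup₂ (f := fun i k => NFAlgebra.dist i (a i k) (b i k)) i k

/-- The distance `Ξ` takes the value `0` on equal arrows and `1` on different ones, so
that non-expansiveness for `Ξ` is preservation of equality. -/
theorem NFAlgebra_homDist_le {v w : List Ty} {i j : Ty} {f f' : NFAlgebra.Hom v i}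
    {g g' : NFAlgebra.Hom w j} (h : f = f' → g = g') :
    NFAlgebra.homDist g g' ≤ NFAlgebra.homDist f f' := by
  refine sInf_le_sInf fun δ hδ x y => ?_
  by_cases h1 : 1 ≤ δ
  · exact le_max_of_le_left ((NFAlgebra_dist_le_one _ _).trans h1)
  · have hf : f = f' := Subtype.ext <| funext fun z => by
      by_contra hz
      have hδz := hδ z z
      rw [NFAlgebra_dist_eq_one hz] at hδz
      exact h1 (hδz.trans (max_le le_rfl ((NFAlgebra_tupleDist_eq_zero z).trans_le zero_le)))
    rw [h hf]
    exact le_max_of_le_right (g'.2.1 x y)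

/-- Functions given by substitution into an open term. -/
def IsDefinable {w : List Ty} {j : Ty} (f : Tuple NF w → NF j) : Prop :=
  ∃ t : Term Var w j, ∀ a, BetaEta (f a).toTerm (t.subst fun _ k => (a _ k).toTerm)

/-- The closure `λ x₁ … xₙ. t` of an open term. -/
def Term.lams {V : Ty → Type} : ∀ {w : List Ty} {j : Ty}, Term V w j → Term V [] (arrows w j)
  | [], _, t => t
  | _ :: w, _, t => Term.lams (w := w) (.lam t)

theorem Term.subst_nil {V : Ty → Type} {σ : Ty} (t : Term V [] σ)
    (f : ∀ σ, Idx [] σ → Term V [] σ) : t.subst f = t := by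
  have hf : f = fun _ k => .bvar k := by
    funext σ k
    cases k
  rw [hf, Term.subst_bvar]

theorem IsDefinable.app_proj {w : List Ty} {i j : Ty} {f : Tuple NF w → NF (Ty.arr i j)}
    (hf : IsDefinable f) :
    IsDefinable fun a : Tuple NF (i :: w) => (f fun _ k => a _ k.succ).app (a _ .zero) := by
  obtain ⟨t, ht⟩ := hf
  refine ⟨.app (t.weaken i) (.bvar .zero), fun a => (NF.betaEta_app _ _).symm.trans ?_⟩
  simp only [Term.subst, Term.weaken, Term.subst_rename]
  exact .app (ht _) (.refl _)

theorem isDefinable_apps : ∀ {w : List Ty} {j : Ty} (c : NF (arrows w j)),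
    IsDefinable (NFAlgebra.apps w j c)
  | [], j, c => ⟨Nf.toTerm (σ := j) c, fun _ =>
      (Term.subst_nil (σ := j) (Nf.toTerm c) _).symm ▸ .refl _⟩
  | _ :: w, _, c => (isDefinable_apps (w := w) c).app_proj

theorem betaEta_apps_of_betaEta_lams : ∀ {w : List Ty} {j : Ty} {c : NF (arrows w j)}
    {t : Term Var w j}, BetaEta c.toTerm t.lams → ∀ a : Tuple NF w,
    BetaEta (Nf.toTerm (NFAlgebra.apps w j c a)) (t.subst fun _ k => (a _ k).toTerm)
  | [], _, c, t, h, a => by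
    rw [Term.subst_nil]
    exact h
  | i :: w, j, c, t, h, a => by
    have ih := betaEta_apps_of_betaEta_lams (w := w) (c := c) (t := .lam t) h fun _ k => a _ k.succ
    refine (NF.betaEta_app _ _).symm.trans ((ih.app (.refl _)).trans ((BetaEta.beta _ _).trans ?_))
    rw [Term.inst_subst_liftSub]
    have : (Tuple.snoc (A := Term Var []) (fun σ (k : Idx w σ) => (a σ k.succ).toTerm)
        (a i .zero).toTerm) = fun _ k => (a _ k).toTerm := by
      funext σ k
      cases k <;> rfl
    rw [this]
    exact .refl _

theorem NFAlgebra_clos_par {w : List Ty} {j : Ty} (c : NF (arrows w j)) :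
    NFAlgebra.clos w j (.par c) = c := by
  refine Nf.eq_of_betaEta ((betaEta_normalForm _).symm.trans ?_)
  change BetaEta (Term.weakenAll [] c.toTerm) c.toTerm
  rw [Term.weakenAll, Term.rename_eq_subst, Term.subst_nil]
  exact .refl _

/-- Closed terms with constants in the algebra and open terms define the same functions: the
closed term can be taken to be a single constant. -/
theorem isArrow_iff_isDefinable {w : List Ty} {j : Ty} {f : Tuple NF w → NF j} :
    NFAlgebra.IsArrow f ↔ IsDefinable f := by
  refine ⟨fun ⟨_, t, ht⟩ => ?_, fun ⟨t, ht⟩ =>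
    ⟨NFAlgebra_dist_le_tupleDist f, .par (normalForm t.lams), fun a => ?_⟩⟩
  · obtain rfl : f = NFAlgebra.apps w j (NFAlgebra.clos w j t) := funext ht
    exact isDefinable_apps _
  · rw [NFAlgebra_clos_par]
    exact Nf.eq_of_betaEta ((ht a).trans
      (betaEta_apps_of_betaEta_lams (betaEta_normalForm _).symm a).symm)

theorem isMulticategory_NFAlgebra : NFAlgebra.IsMulticategory where
  proj k := isArrow_iff_isDefinable.2 ⟨.bvar k, fun _ => .refl _⟩
  comp h g := by
    obtain ⟨t, ht⟩ := isArrow_iff_isDefinable.1 h.2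
    choose u hu using fun i k => isArrow_iff_isDefinable.1 (g i k).2
    refine isArrow_iff_isDefinable.2 ⟨t.subst u, fun z => (ht _).trans ?_⟩
    rw [Term.subst_subst]
    exact BetaEta.subst_congr (fun i k => hu i k z) t

/-- Currying: `Λ(h)(a) = Λ(t) · a` for a chosen closed term `t` that represents `h`. -/
noncomputable def NFAlgebra.curry (w : List Ty) (i j : Ty) (h : NFAlgebra.Hom (i :: w) j) :
    NFAlgebra.Hom w (Ty.arr i j) :=
  ⟨NFAlgebra.apps w (Ty.arr i j) (NFAlgebra.clos (i :: w) j h.2.2.choose),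
    isArrow_iff_isDefinable.2 (isDefinable_apps (w := w) _)⟩

/-- Uncurrying: `Ev(f)(z, x) = f(z) · x`. -/
noncomputable def NFAlgebra.uncurry (w : List Ty) (i j : Ty) (f : NFAlgebra.Hom w (Ty.arr i j)) :
    NFAlgebra.Hom (i :: w) j :=
  ⟨fun a => NFAlgebra.app (f.1 fun _ k => a _ k.succ) (a _ .zero),
    isArrow_iff_isDefinable.2 (isArrow_iff_isDefinable.1 f.2).app_proj⟩

theorem NFAlgebra.app_curry {w : List Ty} {i j : Ty} (h : NFAlgebra.Hom (i :: w) j)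
    (a : Tuple NF w) (x : NF i) :
    NF.app ((NFAlgebra.curry w i j h).1 a) x = h.1 (Tuple.snoc a x) :=
  (h.2.2.choose_spec (Tuple.snoc a x)).symm

theorem Tuple.snoc_succ_zero {A : Ty → Type} {w : List Ty} {i : Ty} (a : Tuple A (i :: w)) :
    Tuple.snoc (fun _ k => a _ k.succ) (a _ .zero) = a := by
  funext σ k
  cases k <;> rfl

theorem isExponential_NFAlgebra : NFAlgebra.IsExponential NFAlgebra.curry NFAlgebra.uncurry where
  lam_apply _ _ _ h _ ht a := NF.ext_app fun x =>
    (NFAlgebra.app_curry h a x).trans (ht (Tuple.snoc a x))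
  ev_apply _ _ _ _ _ _ := rfl
  ev_lam _ _ _ h := Subtype.ext <| funext fun a =>
    (NFAlgebra.app_curry h _ _).trans (congrArg h.1 (Tuple.snoc_succ_zero a))
  lam_ev _ _ _ _ := Subtype.ext <| funext fun a => NF.ext_app fun x => NFAlgebra.app_curry _ a x
  lam_natural _ _ _ _ _ h h' hh z := NF.ext_app fun x =>
    (NFAlgebra.app_curry h' z x).trans ((hh z x).trans (NFAlgebra.app_curry h _ x).symm)
  ev_natural _ _ _ _ _ _ _ hf z x := congrArg (NFAlgebra.app · x) (hf z)
  lam_nonexpansive _ _ _ _ _ := NFAlgebra_homDist_le (congrArg _)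
  ev_nonexpansive _ _ _ _ _ := NFAlgebra_homDist_le (congrArg _)

end STLC

theorem mainTheorem9 :
    (∀ (σ : STLC.Ty) (t : STLC.Term STLC.Var [] σ),
      ∃! u : STLC.NF σ, STLC.BetaEta t u.toTerm) ∧
    (∀ σ : STLC.Ty,
      STLC.IsPartialUltrametric (fun t s : STLC.NF σ => (STLC.dNF σ t s : ENNReal))) ∧
    (∀ (σ τ : STLC.Ty) (t t' : STLC.NF (STLC.Ty.arr σ τ)) (s s' : STLC.NF σ),
      STLC.dNF τ (t.app s) (t'.app s') ≤
        max (STLC.dNF (STLC.Ty.arr σ τ) t t') (STLC.dNF σ s s')) ∧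
    STLC.NFAlgebra.IsPartialQuantitativeExtensionalLambdaAlgebra := by
  refine ⟨fun σ t => ?_, STLC.isPartialUltrametric_dNF, fun _ _ => STLC.dNF_app_le,
    ⟨STLC.isPartialUltrametric_dNF, fun f g a b => ?_, ?_⟩, STLC.isMulticategory_NFAlgebra,
    _, _, STLC.isExponential_NFAlgebra⟩
  · obtain ⟨u, hu⟩ := STLC.exists_betaEta_toTerm t
    exact ⟨u, hu, fun v hv => STLC.Nf.eq_of_betaEta (hv.symm.trans hu)⟩
  · exact (ENNReal.coe_le_coe.2 (STLC.dNF_app_le f g a b)).trans_eq (ENNReal.coe_max _ _)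
  · exact (STLC.NFAlgebra_dist_eq_zero (i := STLC.Ty.o) _).le
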